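/- **Setting.** Let $W$ be a standard one-dimensional Wiener process on a filtered probability space satisfying the usual conditions, let $\alpha\in\mathbb R$, $\sigma\neq0$, $T\ge 0$, and let $D=[0,T)\times(0,\infty)$. The economy has a constant-returns production technology $dS=\alpha S\,dt+\sigma S\,dW$, a risk free asset in zero net supply $dB=r(t,X_t)B\,dt$ with $r:D\to\mathbb R$ continuous, and a representative agent who chooses a feedback law $(u,c)$, where $u(t,x)\ge0$ is the portfolio weight on production and $c(t,x)\ge 0$ the consumption rate. Her wealth $X>0$ satisfies, on $[t,T)$, $$dX_s=X_su_s(\alpha-r_s)\,ds+(r_sX_s-c_s)\,ds+X_su_s\sigma\,dW_s ,\qquad X_t=x .$$ Sitting at $(t,x)$, she values a law by $J(t,x;u,c)=E_{t,x}\big[\int_t^T U(t,x,s,c_s)\,ds\big]$, where $U(t,x,s,c)$ is finite for $c>0$ and either finite for $c=0$ everywhere or $-\infty$ for $c=0$ everywhere. A law is *admissible* if it is measurable, satisfies the constraints (with finite utility), has a pathwise unique positive wealth process from every $(t,x)\in D$, and has integrable utility in $J(t,x;u,c)$ for every $(t,x)\in D$. A triple $(\hat c,\hat u,r)$ is a *market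 equilibrium* if * $(\hat u,\hat c)$ is an intrapersonal equilibrium given $r$: it is admissible, and for every $(t,x)\in D$ and every admissible $v$, $\liminf_{h\downarrow0}\frac1h\{J(t,x;\hat u,\hat c)-J(t,x;v_h)\}\ge0$, where $v_h$ equals $v$ on $[t,t+h)$ and $(\hat u,\hat c)$ afterwards (this is required when $v_h$ is admissible for all small $h$); * the market for the risk free asset clears, $\hat u\equiv1$ on $D$. For $f(t,x,s,y)=f^{sy}(t,x)$ write $f_t,f_x,f_{xx}$ for the derivatives in the first two arguments ($f_t$ is the right derivative at $t=0$), and put $$\mathbf A^{u,c}f^{sy}(t,x)=f_t+xu(\alpha-r)f_x+(rx-c)f_x+\tfrac12x^2u^2\sigma^2f_{xx}.$$ The intrapersonal equilibrium is determined by the *extended HJB system*: for all $(t,x),(s,y)\in D$, $f^{sy}$ is $C^{1,2}$ on $D$, $$\sup_{u\ge0,\,c\ge0}\{U(t,x,t,c)+\mathbf A^{u,c}f^{tx}(t,x)\}=0,\quad\text{attained at } (\hat u,\hat c)(t,x),$$ $$\mathbf A^{\hat u,\hat c}f^{sy}(t,x)+U(s,y,t,\hat c(t,x))=0,\qquad f^{sy}(T,\cdot)=0\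 \text{ on }(0,\infty),$$ and $f^{sy}(t,x)=E_{t,x}\big[\int_t^TU(s,y,\tau,\hat c(\tau,X_\tau))\,d\tau\big]$, where the integrand is integrable and $X$ is the wealth process under $(\hat u,\hat c)$. A continuous function $\varphi:D\to\mathbb R$ is an *equilibrium Girsanov kernel* if from each $(t,x)\in D$ the equilibrium system of $X$, $S$, $B$ and $dL_s=L_s\varphi(s,X_s)\,dW_s$, with $X_t=x$ and $S_t=B_t=L_t=1$, has a solution on $[t,T)$ with positive components such that, for each $t'\in[t,T)$, $L$ is a $P$-martingale on $[t,t']$ and $S/B$ is a martingale on $[t,t']$ under $dQ=L_{t'}\,dP$. **Proposition.** Let $(\hat c,\hat u,r)$ be a market equilibrium, let $(\hat u,\hat c)$ and $f$ solve the extended HJB system, let $U(t,x,t,\cdot)$ be differentiable on $(0,\infty)$ with derivative $U_c$ for each $(t,x)\in D$, let the optimum be interior ($\hat c>0$ on $D$), and let $f_x(t,x,t,x)\neq0$ on $D$. Then the following hold for all $(t,x),(s,y)\in D$. 1. The equilibrium short rate is $\displaystyle r(t,x)=\alpha+\sigma^2\frac{x f_{xx}(t,x,t,x)}{f_x(t,x,t,x)}$.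 2. Every equilibrium Girsanov kernel is given by $\displaystyle\varphi(t,x)=\sigma\frac{x f_{xx}(t,x,t,x)}{f_x(t,x,t,x)}$. 3. The extended HJB system takes the form $$U(t,x,t,\hat c)+f_t+(\alpha x-\hat c)f_x+\tfrac12x^2\sigma^2f_{xx}=0\quad\text{at }(t,x,t,x),$$ $$\mathbf A^{\hat c}f^{sy}(t,x)+U(s,y,t,\hat c(t,x))=0,\qquad f^{sy}(T,\cdot)=0\ \text{ on }(0,\infty),$$ where $\mathbf A^{\hat c}=\mathbf A^{1,\hat c}$, that is, $\mathbf A^{\hat c}f^{sy}(t,x)=f_t+(\alpha x-\hat c)f_x+\frac12x^2\sigma^2f_{xx}$ at $(t,x,s,y)$. 4. The equilibrium consumption satisfies $U_c(t,x,t,\hat c(t,x))=f_x(t,x,t,x)$. 5. $\mathbf A^{\hat c}f^{tx}(t,x)=f_t+x(\alpha-r)f_x+(rx-\hat c)f_x+\frac12x^2\sigma^2f_{xx}$ at $(t,x,t,x)$. 6. The equilibrium wealth process exists from every initial point, and the wealth processes under $(\hat u,\hat c)$ are exactly the positive solutions of $dX_s=(\alpha X_s-\hat c_s)\,ds+X_s\sigma\,dW_s$.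 -/

import Mathlib

open Set Filter Topology MeasureTheory ProbabilityTheory
open scoped NNReal ENNReal

/-! ## Stochastic differential equations driven by a one-dimensional Wiener process -/

/-- A filtered probability space satisfying the usual conditions, carrying a standard
one-dimensional Wiener process `W` relative to its filtration. -/
structure WienerBasis (Ω : Type*) [MeasurableSpace Ω] where
  P : Measure Ω
  isProbabilityMeasure : IsProbabilityMeasure P
  filt : Filtration ℝ≥0 ‹MeasurableSpace Ω›
  rightContinuous : filt.IsRightContinuous
  complete : ∀ A : Set Ω, P A = 0 → ∀ t, MeasurableSet[filt t] A
  W : ℝ≥0 → Ω → ℝ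
  brownian : IsBrownianReal W P
  adapted : StronglyAdapted filt W
  indep : ∀ s t : ℝ≥0, s ≤ t →
    Indep (MeasurableSpace.comap (fun ω => W t ω - W s ω) inferInstance) (filt s) P

section SDE

variable {Ω : Type*} [MeasurableSpace Ω] {E : Type*} [NormedAddCommGroup E] [NormedSpace ℝ E]

/-- The second order operator of the pair `(Y, W)` when `dY = b ds + a dW`: the pair has drift
vector `(b, 0)` and diffusion vector `(a, 1)`, so the operator sends `ψ(y, w)` to
`ψ_y b + (1/2) (ψ_yy[a, a] + 2 ψ_yw[a] + ψ_ww)`. -/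
noncomputable def itoOperator (b a : E) (ψ : E × ℝ → ℝ) (z : E × ℝ) : ℝ :=
  fderiv ℝ ψ z (b, 0) + 1 / 2 * iteratedFDeriv ℝ 2 ψ z (fun _ => (a, 1))

/-- `ψ(Y_s, W_s) - ψ(Y_t, W_t) - ∫_t^s (itoOperator ψ)(Y_q, W_q) dq`. -/
noncomputable def itoDefect (𝔅 : WienerBasis Ω) (b a : ℝ → E → E) (t : ℝ≥0) (Y : ℝ≥0 → Ω → E)
    (ψ : E × ℝ → ℝ) (s : ℝ≥0) (ω : Ω) : ℝ :=
  ψ (Y s ω, 𝔅.W s ω) - ψ (Y t ω, 𝔅.W t ω)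
    - ∫ q in (t : ℝ)..s,
        itoOperator (b q (Y q.toNNReal ω)) (a q (Y q.toNNReal ω)) ψ
          (Y q.toNNReal ω, 𝔅.W q.toNNReal ω)

/-- Time `s` frozen outside `[t, t']`. -/
def clampTime (t t' s : ℝ≥0) : ℝ≥0 := max t (min s t')

/-- `Y` solves `dY_s = b(s, Y_s) ds + a(s, Y_s) dW_s`, `Y_t = y₀`, on the time interval `[t, T)`
with values in the (open) state space `O`, driven by the given Wiener process `W`.

The equation is expressed by the martingale problem for the *pair* `(Y, W)`: for every `C²`
function `ψ(y, w)` the process `ψ(Y, W) - ∫ (itoOperator ψ)(Y, W) ds` is a local martingale.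
As `W` is a component of the pair, this pins `Y` down as `y₀ + ∫ b ds + ∫ a dW` for the given `W`
(and not merely in law), and conversely it holds for such `Y` by Itô's formula. -/
structure SolvesSDE (𝔅 : WienerBasis Ω) (b a : ℝ → E → E) (O : Set E) (T t : ℝ≥0) (y₀ : E)
    (Y : ℝ≥0 → Ω → E) : Prop where
  adapted : ∀ s ∈ Ico t T, StronglyMeasurable[𝔅.filt s] (Y s)
  mem : ∀ s ∈ Ico t T, ∀ ω, Y s ω ∈ O
  continuousOn : ∀ ω, ContinuousOn (fun s => Y s ω) (Ico t T)
  initial : ∀ ω, Y t ω = y₀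
  drift_integrable : ∀ᵐ ω ∂𝔅.P, ∀ t' ∈ Ico t T,
    IntegrableOn (fun q : ℝ => b q (Y q.toNNReal ω)) (Icc (t : ℝ) t')
  diffusion_memLp : ∀ᵐ ω ∂𝔅.P, ∀ t' ∈ Ico t T,
    MemLp (fun q : ℝ => a q (Y q.toNNReal ω)) 2 (volume.restrict (Icc (t : ℝ) t'))
  localMartingale : ∀ t' ∈ Ico t T, ∀ ψ : E × ℝ → ℝ, ContDiffOn ℝ 2 ψ (O ×ˢ univ) →
    Locally (fun M => Martingale M 𝔅.filt 𝔅.P) 𝔅.filt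
      (fun s ω => itoDefect 𝔅 b a t Y ψ (clampTime t t' s) ω) 𝔅.P

end SDE

/-! ## Partial derivatives of `f(t, x, s, y) = f^{sy}(t, x)` in the first pair of variables -/

/-- `f_t(t, x, s, y)`; time runs in `[0, ∞)`, so this is the right derivative at `t = 0`. -/
noncomputable def dT (f : ℝ → ℝ → ℝ → ℝ → ℝ) (t x s y : ℝ) : ℝ :=
  derivWithin (fun τ => f τ x s y) (Ici 0) t

/-- `f_x(t, x, s, y)`. -/
noncomputable def dX (f : ℝ → ℝ → ℝ → ℝ → ℝ) (t x s y : ℝ) : ℝ :=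
  deriv (fun ξ => f t ξ s y) x

/-- `f_xx(t, x, s, y)`. -/
noncomputable def dXX (f : ℝ → ℝ → ℝ → ℝ → ℝ) (t x s y : ℝ) : ℝ :=
  deriv (fun ξ => dX f t ξ s y) x

/-! ## The economy -/

/-- The primitives of the economy: the technology `dS = αS dt + σS dW`, the horizon `T`, and the
utility `U(t, x, s, c)` at time `s` of the consumption rate `c` for the agent sitting at `(t, x)`.
`C` is the set of consumption rates at which the utility is finite: it is `[0, ∞)`, or `(0, ∞)`
when the utility of zero consumption is `-∞` (as for logarithmic utility). -/
structure ProductionEconomy where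
  α : ℝ
  σ : ℝ
  σ_ne_zero : σ ≠ 0
  T : ℝ≥0
  U : ℝ → ℝ → ℝ → ℝ → ℝ
  C : Set ℝ
  Ioi_subset_C : Ioi 0 ⊆ C
  C_subset_Ici : C ⊆ Ici 0

/-- A feedback control law: portfolio weight on production `u(t, x)` and consumption `c(t, x)`. -/
structure FeedbackLaw where
  u : ℝ → ℝ → ℝ
  c : ℝ → ℝ → ℝ

open Classical in
/-- The deviation `𝐮_h`: the law `v` on `[t, t + h)`, the law `w` at all other times. -/
noncomputable def FeedbackLaw.deviate (w v : FeedbackLaw) (t h : ℝ) : FeedbackLaw where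
  u s y := if t ≤ s ∧ s < t + h then v.u s y else w.u s y
  c s y := if t ≤ s ∧ s < t + h then v.c s y else w.c s y

namespace ProductionEconomy

variable {Ω : Type*} [MeasurableSpace Ω] (𝓔 : ProductionEconomy)

/-- The points `(t, x)` with `0 ≤ t < T` and positive wealth `x`. -/
def domain : Set (ℝ × ℝ) := Ico (0 : ℝ) 𝓔.T ×ˢ Ioi (0 : ℝ)

/-- Drift of wealth, `x u (α - r) + (r x - c)`. -/
def wealthDrift (r : ℝ → ℝ → ℝ) (u c t x : ℝ) : ℝ :=
  x * u * (𝓔.α - r t x) + (r t x * x - c)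

/-- Diffusion coefficient of wealth, `x u σ`. -/
def wealthVol (u x : ℝ) : ℝ := x * u * 𝓔.σ

/-- `(𝐀^{u,c} f^{sy})(t, x)`, the controlled generator (including `∂/∂t`) acting on `(t, x)`. -/
noncomputable def generator (r : ℝ → ℝ → ℝ) (u c : ℝ) (f : ℝ → ℝ → ℝ → ℝ → ℝ)
    (t x s y : ℝ) : ℝ :=
  dT f t x s y + 𝓔.wealthDrift r u c t x * dX f t x s y
    + 1 / 2 * 𝓔.wealthVol u x ^ 2 * dXX f t x s y

/-- `X` is a wealth process under the law `w` started from wealth `x` at time `t`. -/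
def IsWealth (𝔅 : WienerBasis Ω) (r : ℝ → ℝ → ℝ) (w : FeedbackLaw) (t : ℝ≥0) (x : ℝ)
    (X : ℝ≥0 → Ω → ℝ) : Prop :=
  SolvesSDE 𝔅 (fun s ξ => 𝓔.wealthDrift r (w.u s ξ) (w.c s ξ) s ξ)
    (fun s ξ => 𝓔.wealthVol (w.u s ξ) ξ) (Ioi 0) 𝓔.T t x X

/-- The wealth process under the law `w` started from `(t, x)` (arbitrary if there is none;
for an admissible law it exists and is unique up to indistinguishability). -/
noncomputable def wealth (𝔅 : WienerBasis Ω) (r : ℝ → ℝ → ℝ) (w : FeedbackLaw) (t : ℝ≥0) (x : ℝ) :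
    ℝ≥0 → Ω → ℝ :=
  Classical.epsilon (𝓔.IsWealth 𝔅 r w t x)

/-- The utility rate at time `q` along the wealth process started from `(t, x)`, as valued with the
preferences of the agent sitting at `(s, y)`. -/
noncomputable def utilityRate (𝔅 : WienerBasis Ω) (r : ℝ → ℝ → ℝ) (w : FeedbackLaw) (s y : ℝ)
    (t : ℝ≥0) (x : ℝ) (q : ℝ) (ω : Ω) : ℝ :=
  𝓔.U s y q (w.c q (𝓔.wealth 𝔅 r w t x q.toNNReal ω))

/-- `E_{t,x} ∫_t^T |U(s, y, q, c(q, X_q))| dq < ∞`. -/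
def UtilityIntegrable (𝔅 : WienerBasis Ω) (r : ℝ → ℝ → ℝ) (w : FeedbackLaw) (s y : ℝ) (t : ℝ≥0)
    (x : ℝ) : Prop :=
  Integrable (fun p : Ω × ℝ => 𝓔.utilityRate 𝔅 r w s y t x p.2 p.1)
    (𝔅.P.prod (volume.restrict (Ioo (t : ℝ) 𝓔.T)))

/-- `E_{t,x} ∫_t^T U(s, y, q, c(q, X_q)) dq`. -/
noncomputable def expectedUtility (𝔅 : WienerBasis Ω) (r : ℝ → ℝ → ℝ) (w : FeedbackLaw) (s y : ℝ)
    (t : ℝ≥0) (x : ℝ) : ℝ :=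
  ∫ ω, (∫ q in (t : ℝ)..𝓔.T, 𝓔.utilityRate 𝔅 r w s y t x q ω) ∂𝔅.P

/-- The reward functional `J(t, x, w) = E_{t,x} ∫_t^T U(t, x, s, c_s) ds`. -/
noncomputable def reward (𝔅 : WienerBasis Ω) (r : ℝ → ℝ → ℝ) (w : FeedbackLaw) (t : ℝ≥0)
    (x : ℝ) : ℝ :=
  𝓔.expectedUtility 𝔅 r w t x t x

/-- Admissible control laws: no short position in the technology, nonnegative consumption, a
pathwise unique wealth process from each initial point, and integrable utility. -/
structure IsAdmissible (𝔅 : WienerBasis Ω) (r : ℝ → ℝ → ℝ) (w : FeedbackLaw) : Prop where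
  measurable_u : Measurable fun p : 𝓔.domain => w.u p.1.1 p.1.2
  measurable_c : Measurable fun p : 𝓔.domain => w.c p.1.1 p.1.2
  u_nonneg : ∀ p ∈ 𝓔.domain, 0 ≤ w.u p.1 p.2
  c_mem : ∀ p ∈ 𝓔.domain, w.c p.1 p.2 ∈ 𝓔.C
  exists_wealth : ∀ t < 𝓔.T, ∀ x > 0, ∃ X, 𝓔.IsWealth 𝔅 r w t x X
  unique_wealth : ∀ t < 𝓔.T, ∀ x > 0, ∀ X X', 𝓔.IsWealth 𝔅 r w t x X → 𝓔.IsWealth 𝔅 r w t x X' →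
    ∀ᵐ ω ∂𝔅.P, ∀ s ∈ Ico t 𝓔.T, X s ω = X' s ω
  integrable : ∀ t < 𝓔.T, ∀ x > 0, 𝓔.UtilityIntegrable 𝔅 r w t x t x

/-- Intrapersonal (subgame perfect Nash) equilibrium law: for all admissible `v`,
`liminf_{h ↓ 0} (J(t, x, w) - J(t, x, 𝐮_h)) / h ≥ 0`, where `𝐮_h` follows `v` on `[t, t + h)` and `w`
afterwards. Deviations are tested when `𝐮_h` is itself admissible, so that its reward is defined. -/
structure IsIntrapersonalEquilibrium (𝔅 : WienerBasis Ω) (r : ℝ → ℝ → ℝ) (w : FeedbackLaw) :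
    Prop where
  admissible : 𝓔.IsAdmissible 𝔅 r w
  nash : ∀ v, 𝓔.IsAdmissible 𝔅 r v → ∀ t < 𝓔.T, ∀ x > 0,
    (∀ᶠ h : ℝ in 𝓝[>] 0, 𝓔.IsAdmissible 𝔅 r (w.deviate v t h)) →
    0 ≤ liminf (fun h : ℝ =>
      (((𝓔.reward 𝔅 r w t x - 𝓔.reward 𝔅 r (w.deviate v t h) t x) / h : ℝ) : EReal)) (𝓝[>] 0)

/-- Market equilibrium `(ĉ, û, r)`: given the short rate function `r`, the law `w = (û, ĉ)` is an
intrapersonal equilibrium, and the market for the risk free asset clears, `û ≡ 1`. -/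
structure IsMarketEquilibrium (𝔅 : WienerBasis Ω) (r : ℝ → ℝ → ℝ) (w : FeedbackLaw) : Prop where
  intrapersonal : 𝓔.IsIntrapersonalEquilibrium 𝔅 r w
  clearing : ∀ p ∈ 𝓔.domain, w.u p.1 p.2 = 1

/-- `(t, x) ↦ f^{sy}(t, x)` is of class `C^{1,2}` on `[0, T) × (0, ∞)`. -/
structure IsC12 (f : ℝ → ℝ → ℝ → ℝ → ℝ) (s y : ℝ) : Prop where
  differentiable_t : ∀ p ∈ 𝓔.domain, DifferentiableWithinAt ℝ (fun τ => f τ p.2 s y) (Ici 0) p.1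
  differentiable_x : ∀ p ∈ 𝓔.domain, DifferentiableAt ℝ (fun ξ => f p.1 ξ s y) p.2
  differentiable_xx : ∀ p ∈ 𝓔.domain, DifferentiableAt ℝ (fun ξ => dX f p.1 ξ s y) p.2
  continuousOn : ContinuousOn (fun p : ℝ × ℝ => f p.1 p.2 s y) 𝓔.domain
  continuousOn_t : ContinuousOn (fun p : ℝ × ℝ => dT f p.1 p.2 s y) 𝓔.domain
  continuousOn_x : ContinuousOn (fun p : ℝ × ℝ => dX f p.1 p.2 s y) 𝓔.domain
  continuousOn_xx : ContinuousOn (fun p : ℝ × ℝ => dXX f p.1 p.2 s y) 𝓔.domain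

/-- The function `f` and the law `w = (û, ĉ)` solve the extended HJB system of the agent's problem
given the short rate function `r`:
`sup_{u ≥ 0, c ≥ 0} {U(t, x, t, c) + 𝐀^{u,c} f^{tx}(t, x)} = 0`, realized by `w`, and
`𝐀^{û,ĉ} f^{sy}(t, x) + U(s, y, t, ĉ(t, x)) = 0` with `f^{sy}(T, x) = 0` and the probabilistic
representation of `f^{sy}` as an expected utility under `w`. -/
structure SolvesExtendedHJB (𝔅 : WienerBasis Ω) (r : ℝ → ℝ → ℝ) (w : FeedbackLaw)
    (f : ℝ → ℝ → ℝ → ℝ → ℝ) : Prop where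
  smooth : ∀ p ∈ 𝓔.domain, 𝓔.IsC12 f p.1 p.2
  sup_eq_zero : ∀ p ∈ 𝓔.domain,
    IsLUB {H : ℝ | ∃ u c : ℝ, 0 ≤ u ∧ c ∈ 𝓔.C ∧
      H = 𝓔.U p.1 p.2 p.1 c + 𝓔.generator r u c f p.1 p.2 p.1 p.2} 0
  sup_realized : ∀ p ∈ 𝓔.domain,
    𝓔.U p.1 p.2 p.1 (w.c p.1 p.2)
      + 𝓔.generator r (w.u p.1 p.2) (w.c p.1 p.2) f p.1 p.2 p.1 p.2 = 0
  backward : ∀ q ∈ 𝓔.domain, ∀ p ∈ 𝓔.domain,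
    𝓔.generator r (w.u p.1 p.2) (w.c p.1 p.2) f p.1 p.2 q.1 q.2
      + 𝓔.U q.1 q.2 p.1 (w.c p.1 p.2) = 0
  terminal : ∀ q ∈ 𝓔.domain, ∀ x > 0, f 𝓔.T x q.1 q.2 = 0
  integrable : ∀ q ∈ 𝓔.domain, ∀ t < 𝓔.T, ∀ x > 0, 𝓔.UtilityIntegrable 𝔅 r w q.1 q.2 t x
  representation : ∀ q ∈ 𝓔.domain, ∀ t : ℝ≥0, t < 𝓔.T → ∀ x > 0,
    f t x q.1 q.2 = 𝓔.expectedUtility 𝔅 r w q.1 q.2 t x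

/-- Drift of the market system `(X, S, B, L)`:
`dX = (wealth drift) dt + …`, `dS = αS dt + …`, `dB = rB dt`, `dL = …`. -/
def marketDrift (r : ℝ → ℝ → ℝ) (w : FeedbackLaw) (s : ℝ) (z : ℝ × ℝ × ℝ × ℝ) : ℝ × ℝ × ℝ × ℝ :=
  (𝓔.wealthDrift r (w.u s z.1) (w.c s z.1) s z.1, 𝓔.α * z.2.1, r s z.1 * z.2.2.1, 0)

/-- Diffusion of the market system `(X, S, B, L)`:
`dX = … + X u σ dW`, `dS = … + σS dW`, `dB = …`, `dL = φL dW`. -/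
def marketVol (φ : ℝ → ℝ → ℝ) (w : FeedbackLaw) (s : ℝ) (z : ℝ × ℝ × ℝ × ℝ) : ℝ × ℝ × ℝ × ℝ :=
  (𝓔.wealthVol (w.u s z.1) z.1, 𝓔.σ * z.2.1, 0, φ s z.1 * z.2.2.2)

/-- `φ` is the Girsanov kernel of an equilibrium martingale measure: `φ` is continuous and, for each
initial point `(t, x)`, the system consisting of wealth `X`, the technology `S`, the risk free asset
`B` and the likelihood process `dL_s = L_s φ(s, X_s) dW_s`, `L_t = 1`, has a positive solution for
which `L` is a `P`-martingale, so that `dQ = L_{t'} dP` defines a probability measure on the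
information up to `t' < T`, and `S/B` is a `Q`-martingale. -/
structure IsGirsanovKernel (𝔅 : WienerBasis Ω) (r : ℝ → ℝ → ℝ) (w : FeedbackLaw)
    (φ : ℝ → ℝ → ℝ) : Prop where
  continuousOn : ContinuousOn (fun p : ℝ × ℝ => φ p.1 p.2) 𝓔.domain
  martingaleMeasure : ∀ t < 𝓔.T, ∀ x > 0, ∃ X S B L : ℝ≥0 → Ω → ℝ,
    SolvesSDE 𝔅 (𝓔.marketDrift r w) (𝓔.marketVol φ w) (Ioi 0 ×ˢ Ioi 0 ×ˢ Ioi 0 ×ˢ Ioi 0) 𝓔.T t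
      (x, 1, 1, 1) (fun s ω => (X s ω, S s ω, B s ω, L s ω)) ∧
    ∀ t' ∈ Ico t 𝓔.T,
      Martingale (fun s => L (clampTime t t' s)) 𝔅.filt 𝔅.P ∧
      Martingale (fun s ω => S (clampTime t t' s) ω / B (clampTime t t' s) ω) 𝔅.filt
        (𝔅.P.withDensity fun ω => ENNReal.ofReal (L t' ω))

end ProductionEconomy

/-! Apart from the Girsanov kernel, everything is pointwise calculus. At `û = 1` the weight and the
consumption rate are interior maximizers of the Hamiltonian. The derivative in `u` gives `(α - r)
f_x + σ² x f_xx = 0`, hence the short rate (`portfolio_foc`); the derivative in `c` gives `U_c =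
f_x` (`consumption_foc`). Substituting `u = 1` cancels `r` from the generator and from the wealth
equation, and the backward equation on the diagonal is the HJB equation.

The kernel needs the no-arbitrage relation `α - r + σφ = 0` at every point (`drift_eq_zero`). By
Bayes (`mul_of_withDensity`), `SL/B` is a `P`-martingale. By the martingale problem for the market
system, `SL/B` minus the integral of `(α - r + σφ) SL/B` is a local martingale
(`itoOperator_deflatedTechnology`). A continuous martingale cannot have a drift that starts positive
(`drift_nonpos`): stopping before the drift falls to half its initial value would force a strictly
positive integral to have mean zero. Applying this to `±SL/B` makes the drift vanish at the starting
point, which is an arbitrary point of the domain. Comparison with the short rate then gives `φ`. -/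

/-! ## Optional stopping for continuous martingales -/

section Martingales

variable {Ω : Type*} [mΩ : MeasurableSpace Ω] {P : Measure Ω} {F : Filtration ℝ≥0 mΩ}

/-- Rounding a stopping time up to the grid `ℕ / (k + 1)` gives a stopping time. -/
theorem isStoppingTime_ceil {ρ : Ω → ℝ≥0} (hρ : IsStoppingTime F fun ω => (ρ ω : WithTop ℝ≥0))
    (k : ℕ) :
    IsStoppingTime F fun ω => ((⌈ρ ω * (k + 1)⌉₊ / (k + 1) : ℝ≥0) : WithTop ℝ≥0) := by
  intro i
  have hk : (0 : ℝ≥0) < k + 1 := by positivity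
  -- The rounded time is at most `i` exactly when `ρ` is at most the last grid point not exceeding
  -- `i`, an event already known at time `i`.
  have hle : (⌊i * (k + 1)⌋₊ / (k + 1) : ℝ≥0) ≤ i :=
    (div_le_iff₀ hk).2 (Nat.floor_le (by positivity))
  have : {ω | ((⌈ρ ω * (k + 1)⌉₊ / (k + 1) : ℝ≥0) : WithTop ℝ≥0) ≤ i}
      = {ω | (ρ ω : WithTop ℝ≥0) ≤ (⌊i * (k + 1)⌋₊ / (k + 1) : ℝ≥0)} := by
    ext ω
    simp only [mem_ofPred_eq, WithTop.coe_le_coe]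
    rw [div_le_iff₀ hk, le_div_iff₀ hk, ← Nat.le_floor_iff (by positivity), Nat.ceil_le]
  rw [this]
  exact F.mono hle _ (hρ _)

theorem tendsto_ceil_grid (a : ℝ≥0) :
    Tendsto (fun k : ℕ => (⌈a * (k + 1)⌉₊ / (k + 1) : ℝ≥0)) atTop (𝓝 a) := by
  have h : Tendsto (fun k : ℕ => a + 1 / ((k : ℝ≥0) + 1)) atTop (𝓝 (a + 0)) :=
    tendsto_const_nhds.add tendsto_one_div_add_atTop_nhds_zero_nat
  rw [add_zero] at h
  refine tendsto_of_tendsto_of_tendsto_of_le_of_le tendsto_const_nhds h ?_ ?_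
  · intro k
    have hk : (0 : ℝ≥0) < k + 1 := by positivity
    exact (le_div_iff₀ hk).2 (Nat.le_ceil _)
  · intro k
    have hk : (0 : ℝ≥0) < k + 1 := by positivity
    refine (div_le_iff₀ hk).2 ?_
    rw [add_mul, one_div, inv_mul_cancel₀ hk.ne']
    exact (Nat.ceil_lt_add_one (by positivity)).le

/-- Optional stopping for a continuous martingale at a bounded stopping time. -/
theorem MeasureTheory.Martingale.integral_stopped_of_continuous [IsFiniteMeasure P]
    {M : ℝ≥0 → Ω → ℝ} (hM : Martingale M F P) (hcont : ∀ ω, Continuous fun s => M s ω)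
    {ρ : Ω → ℝ≥0} (hρ : IsStoppingTime F fun ω => (ρ ω : WithTop ℝ≥0)) {n : ℝ≥0}
    (hn : ∀ ω, ρ ω ≤ n) :
    Integrable (fun ω => M (ρ ω) ω) P ∧ ∫ ω, M (ρ ω) ω ∂P = ∫ ω, M n ω ∂P := by
  -- Approximation from above by times of countable range, where optional stopping is available; the
  -- cap `n` keeps them bounded.
  set ρ' : ℕ → Ω → ℝ≥0 := fun k ω => min (⌈ρ ω * (k + 1)⌉₊ / (k + 1) : ℝ≥0) n with hρ'
  have hst : ∀ k, IsStoppingTime F fun ω => (ρ' k ω : WithTop ℝ≥0) := by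
    intro k
    have := (isStoppingTime_ceil hρ k).min_const n
    simpa [hρ'] using this
  have hle : ∀ k ω, (ρ' k ω : WithTop ℝ≥0) ≤ n := fun k ω =>
    WithTop.coe_le_coe.2 (min_le_right _ _)
  have hcount : ∀ k, (range fun ω => (ρ' k ω : WithTop ℝ≥0)).Countable := by
    intro k
    refine (countable_range fun m : ℕ =>
      ((min ((m : ℝ≥0) / (k + 1)) n : ℝ≥0) : WithTop ℝ≥0)).mono ?_
    rintro _ ⟨ω, rfl⟩
    exact ⟨⌈ρ ω * (k + 1)⌉₊, rfl⟩
  have hae : ∀ k, P[M n | (hst k).measurableSpace] =ᵐ[P] fun ω => M (ρ' k ω) ω := by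
    intro k
    have := hM.stoppedValue_ae_eq_condExp_of_le_const_of_countable_range (hst k) (hle k) (hcount k)
    exact this.symm
  -- Conditional expectations of the single variable `M n` are uniformly integrable, so the
  -- pointwise limit supplied by continuity is also an `L¹` limit.
  have hUI : UniformIntegrable (fun k ω => M (ρ' k ω) ω) 1 P :=
    ((hM.integrable n).uniformIntegrable_condExp
      fun k => (hst k).measurableSpace_le).ae_eq hae
  have hlim : ∀ ω, Tendsto (fun k => M (ρ' k ω) ω) atTop (𝓝 (M (ρ ω) ω)) := by
    intro ω
    refine ((hcont ω).tendsto _).comp ?_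
    have := (tendsto_ceil_grid (ρ ω)).min (tendsto_const_nhds (x := n))
    rwa [min_eq_left (hn ω)] at this
  have hint : Integrable (fun ω => M (ρ ω) ω) P :=
    hUI.integrable_of_ae_tendsto (ae_of_all _ hlim)
  refine ⟨hint, ?_⟩
  have hL1 := tendsto_Lp_finite_of_tendsto_ae le_rfl ENNReal.one_ne_top hUI.1
    (memLp_one_iff_integrable.2 hint) hUI.2.1 (ae_of_all _ hlim)
  have hconv := tendsto_integral_of_L1' (fun ω => M (ρ ω) ω) hint.aestronglyMeasurable
    (Eventually.of_forall fun k => memLp_one_iff_integrable.1 (hUI.memLp k)) hL1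
  have hconst : ∀ k, ∫ ω, M (ρ' k ω) ω ∂P = ∫ ω, M n ω ∂P := by
    intro k
    rw [← integral_congr_ae (hae k), integral_condExp (hst k).measurableSpace_le]
  simp only [hconst] at hconv
  exact tendsto_nhds_unique hconv tendsto_const_nhds

/-- The first time before `n` at which a continuous process drops below the level `κ` is a stopping
time of a right continuous filtration. -/
theorem isStoppingTime_sInf_lt [F.IsRightContinuous] {G : ℝ≥0 → Ω → ℝ} (hG : StronglyAdapted F G)
    (hcont : ∀ ω, Continuous fun s => G s ω) (κ : ℝ) (n : ℝ≥0) :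
    IsStoppingTime F fun ω => ((sInf ({s | G s ω < κ} ∪ {n}) : ℝ≥0) : WithTop ℝ≥0) := by
  -- Right continuity reduces the claim to strict inequalities. The times with `G < κ` form an open
  -- set, so a countable dense set of times detects them.
  refine isStoppingTime_of_measurableSet_lt_of_isRightContinuous fun i => ?_
  have hset : {ω | ((sInf ({s | G s ω < κ} ∪ {n}) : ℝ≥0) : WithTop ℝ≥0) < i}
      = {ω | ∃ q ∈ range (TopologicalSpace.denseSeq ℝ≥0), q < i ∧ G q ω < κ} ∪ {_ω | n < i} := by
    ext ω
    simp only [mem_ofPred_eq, WithTop.coe_lt_coe, mem_union]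
    rw [csInf_lt_iff (OrderBot.bddBelow _) ⟨n, by simp⟩]
    constructor
    · rintro ⟨s, hs | hs, hsi⟩
      · left
        have hopen : IsOpen {q : ℝ≥0 | q < i ∧ G q ω < κ} :=
          (isOpen_lt continuous_id continuous_const).inter
            (isOpen_lt (hcont ω) continuous_const)
        obtain ⟨q, hq⟩ := (TopologicalSpace.denseRange_denseSeq ℝ≥0).exists_mem_open hopen
          ⟨s, hsi, hs⟩
        exact ⟨_, ⟨q, rfl⟩, hq.1, hq.2⟩
      · right
        rw [mem_singleton_iff] at hs
        exact hs ▸ hsi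
    · rintro (⟨q, -, hqi, hq⟩ | h)
      · exact ⟨q, Or.inl hq, hqi⟩
      · exact ⟨n, Or.inr rfl, h⟩
  rw [hset]
  refine MeasurableSet.union ?_ (MeasurableSet.const _)
  have : {ω | ∃ q ∈ range (TopologicalSpace.denseSeq ℝ≥0), q < i ∧ G q ω < κ}
      = ⋃ q ∈ range (TopologicalSpace.denseSeq ℝ≥0), {ω | q < i ∧ G q ω < κ} := by
    ext ω; simp
  rw [this]
  refine MeasurableSet.biUnion (countable_range _) fun q _ => ?_
  by_cases hq : q < i
  · simp only [hq, true_and]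
    exact F.mono hq.le _ ((hG q).measurable measurableSet_Iio)
  · simp [hq]

/-! ### Drift of a continuous martingale. -/

theorem clampTime_mem {t t' : ℝ≥0} (h : t ≤ t') (s : ℝ≥0) : clampTime t t' s ∈ Icc t t' :=
  ⟨le_max_left _ _, max_le h (min_le_right _ _)⟩

theorem clampTime_of_mem {t t' s : ℝ≥0} (h : s ∈ Icc t t') : clampTime t t' s = s := by
  simp [clampTime, h.1, h.2]

theorem clampTime_of_le {t t' s : ℝ≥0} (h : s ≤ t) : clampTime t t' s = t := by
  simp [clampTime, h]

theorem continuous_clampTime (t t' : ℝ≥0) : Continuous (clampTime t t') := by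
  unfold clampTime; fun_prop

/-- If a continuous martingale `N` is the sum of its initial value, the integral of a continuous
adapted process `G` and a local martingale, then `G` does not start at a positive value. -/
theorem drift_nonpos [IsProbabilityMeasure P] [F.IsRightContinuous] {t t' : ℝ≥0} (htt : t < t')
    {N G : ℝ≥0 → Ω → ℝ} {n₀ g₀ : ℝ} (hN : Martingale N F P)
    (hNcont : ∀ ω, Continuous fun s => N s ω) (hN₀ : ∀ ω, N 0 ω = n₀)
    (hG : StronglyAdapted F G) (hGcont : ∀ ω, Continuous fun s => G s ω) (hG₀ : ∀ ω, G t ω = g₀)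
    (hGt : ∀ ω, ∀ s ≤ t, G s ω = g₀)
    (hloc : Locally (fun M => Martingale M F P) F (fun s ω => N s ω - n₀
      - ∫ q in (t : ℝ)..(clampTime t t' s), G q.toNNReal ω) P) :
    g₀ ≤ 0 := by
  by_contra! hg
  set A : ℝ≥0 → Ω → ℝ := fun s ω => ∫ q in (t : ℝ)..(clampTime t t' s), G q.toNNReal ω with hA
  have hGint : ∀ ω, Continuous fun q : ℝ => G q.toNNReal ω := fun ω =>
    (hGcont ω).comp continuous_real_toNNReal
  have hA₀ : ∀ ω, ∀ s ≤ t, A s ω = 0 := fun ω s hs => by simp [hA, clampTime_of_le hs]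
  have hAcont : ∀ ω, Continuous fun s => A s ω := by
    intro ω
    have := intervalIntegral.continuous_primitive (μ := volume)
      (fun a b => (hGint ω).intervalIntegrable a b) t
    exact this.comp (NNReal.continuous_coe.comp (continuous_clampTime t t'))
  -- Up to `ρ` the drift stays above `g₀ / 2`, so `A` grows at least linearly from `t` on; `ρ > t`
  -- by continuity at `t` and because `G` is frozen at `g₀` before `t`.
  set ρ : Ω → ℝ≥0 := fun ω => sInf ({s | G s ω < g₀ / 2} ∪ {t'}) with hρdef
  have hρ : IsStoppingTime F fun ω => (ρ ω : WithTop ℝ≥0) :=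
    isStoppingTime_sInf_lt hG hGcont (g₀ / 2) t'
  have hρle : ∀ ω, ρ ω ≤ t' := fun ω => csInf_le (OrderBot.bddBelow _) (Or.inr rfl)
  have hGρ : ∀ ω, ∀ s < ρ ω, g₀ / 2 ≤ G s ω := by
    intro ω s hs
    by_contra! h
    have : ρ ω ≤ s := csInf_le (OrderBot.bddBelow _) (mem_union_left _ h)
    exact this.not_gt hs
  have htρ : ∀ ω, t < ρ ω := by
    intro ω
    have hev : ∀ᶠ s in 𝓝 t, g₀ / 2 < G s ω :=
      (hGcont ω).continuousAt.eventually (lt_mem_nhds (by simp only [hG₀]; linarith))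
    obtain ⟨u, hu, hsub⟩ := exists_Ico_subset_of_mem_nhds hev ⟨t', htt⟩
    refine (lt_min hu htt).trans_le (le_csInf ⟨t', Or.inr rfl⟩ ?_)
    rintro s (hs | hs)
    · by_contra! h
      have hs' : G s ω < g₀ / 2 := hs
      rcases le_total s t with hst | hst
      · rw [hGt ω s hst] at hs'; linarith
      · exact absurd (hsub ⟨hst, h.trans_le (min_le_left _ _)⟩) (not_lt.2 hs'.le)
    · rw [mem_singleton_iff] at hs
      exact hs ▸ min_le_right _ _
  have hAlow : ∀ ω, ∀ s, t ≤ s → s ≤ ρ ω → g₀ / 2 * ((s : ℝ) - t) ≤ A s ω := by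
    intro ω s hts hsρ
    have h1 : clampTime t t' s = s := clampTime_of_mem ⟨hts, hsρ.trans (hρle ω)⟩
    have h2 : ∫ _q in (t : ℝ)..s, g₀ / 2 = g₀ / 2 * ((s : ℝ) - t) := by
      rw [intervalIntegral.integral_const, smul_eq_mul, mul_comm]
    simp only [hA, h1]
    rw [← h2]
    refine intervalIntegral.integral_mono_on_of_le_Ioo (by exact_mod_cast hts) (by simp)
      ((hGint ω).intervalIntegrable _ _) fun q hq => hGρ ω _ ?_
    have hq0 : 0 ≤ q := t.2.trans hq.1.le
    have : q.toNNReal < s := by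
      rw [← NNReal.coe_lt_coe, Real.coe_toNNReal _ hq0]; exact hq.2
    exact this.trans_le hsρ
  have hAnonneg : ∀ ω, ∀ s ≤ ρ ω, 0 ≤ A s ω := by
    intro ω s hs
    rcases le_total s t with h | h
    · exact (hA₀ ω s h).ge
    · refine le_trans (mul_nonneg (by linarith) ?_) (hAlow ω s h hs)
      exact sub_nonneg.2 (by exact_mod_cast h)
  obtain ⟨τ, hτ, hMτ⟩ := hloc
  -- At `ρ ∧ τ n` both `N - n₀` and the local martingale have mean zero, hence so does their
  -- difference `A`; as `A` is nonnegative there, it vanishes almost surely.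
  have hzero : ∀ n, ∀ᵐ ω ∂P, A (min (ρ ω : WithTop ℝ≥0) (τ n ω)).untopA ω = 0 := by
    intro n
    set σ : Ω → ℝ≥0 := fun ω => (min (ρ ω : WithTop ℝ≥0) (τ n ω)).untopA with hσdef
    have hσcoe : ∀ ω, (σ ω : WithTop ℝ≥0) = min (ρ ω : WithTop ℝ≥0) (τ n ω) := by
      intro ω
      have h : min (ρ ω : WithTop ℝ≥0) (τ n ω) ≠ ⊤ :=
        ne_top_of_le_ne_top WithTop.coe_ne_top (min_le_left _ _)
      simp only [hσdef]
      rw [WithTop.untopA_eq_untop h, WithTop.coe_untop]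
    have hσρ : ∀ ω, σ ω ≤ ρ ω := fun ω =>
      WithTop.coe_le_coe.1 ((hσcoe ω).le.trans (min_le_left _ _))
    have hσ : IsStoppingTime F fun ω => (σ ω : WithTop ℝ≥0) := by
      simp only [hσcoe]
      exact hρ.min (hτ.isStoppingTime n)
    obtain ⟨hNint, hNeq⟩ := hN.integral_stopped_of_continuous hNcont hσ
      fun ω => (hσρ ω).trans (hρle ω)
    set D : ℝ≥0 → Ω → ℝ := fun s ω => N s ω - n₀ - A s ω with hD
    have hDcont : ∀ ω, Continuous fun s => D s ω := fun ω =>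
      ((hNcont ω).sub continuous_const).sub (hAcont ω)
    have hD₀ : ∀ ω, D 0 ω = 0 := fun ω => by simp [hD, hN₀, hA₀ ω 0 zero_le]
    set M := stoppedProcess (fun i => {ω | ⊥ < τ n ω}.indicator (D i)) (τ n) with hMdef
    -- The indicator of `⊥ < τ n` in the localization is harmless: where `τ n = 0` the stopped value
    -- is `D 0 = 0` anyway.
    have hMeq : ∀ s ω, M s ω = D (min (s : WithTop ℝ≥0) (τ n ω)).untopA ω := by
      intro s ω
      by_cases h : ⊥ < τ n ω
      · simp only [hMdef, stoppedProcess, indicator, mem_ofPred_eq, h, if_true]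
      · have h0 : τ n ω = ((0 : ℝ≥0) : WithTop ℝ≥0) := not_bot_lt_iff.1 h
        have : (min (s : WithTop ℝ≥0) (τ n ω)).untopA = 0 := by
          rw [h0, min_eq_right (WithTop.coe_le_coe.2 zero_le)]; rfl
        simp only [hMdef, stoppedProcess, indicator, mem_ofPred_eq, h, if_false, this, hD₀]
    have hMcont : ∀ ω, Continuous fun s => M s ω := by
      intro ω
      simp only [hMeq]
      refine (hDcont ω).comp ?_
      rcases eq_or_ne (τ n ω) ⊤ with h | h
      · simp only [h, min_top_right]; exact continuous_id
      · lift τ n ω to ℝ≥0 using h with u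
        have : ∀ s : ℝ≥0, (min (s : WithTop ℝ≥0) (u : WithTop ℝ≥0)).untopA = min s u := by
          intro s; rw [← WithTop.coe_min]; rfl
        simp only [this]
        fun_prop
    obtain ⟨hMint, hMe⟩ : Integrable (fun ω => M (ρ ω) ω) P ∧
        ∫ ω, M (ρ ω) ω ∂P = ∫ ω, M t' ω ∂P := Martingale.integral_stopped_of_continuous (hMτ n) hMcont hρ hρle
    have hM0 : ∀ ω, M 0 ω = 0 := by
      intro ω
      rw [hMeq]
      have : (min ((0 : ℝ≥0) : WithTop ℝ≥0) (τ n ω)).untopA = 0 := by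
        rw [min_eq_left (by exact bot_le)]; rfl
      rw [this, hD₀]
    have hMzero : ∫ ω, M (ρ ω) ω ∂P = 0 := by
      rw [hMe]
      have := Martingale.setIntegral_eq (hMτ n) (zero_le (a := t')) (s := univ) MeasurableSet.univ
      rw [setIntegral_univ, setIntegral_univ] at this
      exact this.symm.trans (by simp_rw [← hMdef, hM0]; simp)
    have hNn₀ : ∫ ω, N (σ ω) ω ∂P = n₀ := by
      rw [hNeq]
      have := hN.setIntegral_eq (zero_le (a := t')) (s := univ) MeasurableSet.univ
      rw [setIntegral_univ, setIntegral_univ] at this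
      rw [← this]; simp [hN₀]
    have hAσ : ∀ ω, A (σ ω) ω = N (σ ω) ω - n₀ - M (ρ ω) ω := by
      intro ω
      rw [hMeq]
      change _ = _ - (N (σ ω) ω - n₀ - A (σ ω) ω)
      ring
    have hAint : Integrable (fun ω => A (σ ω) ω) P := by
      simp_rw [hAσ]
      exact (hNint.sub (integrable_const _)).sub hMint
    have hAz : ∫ ω, A (σ ω) ω ∂P = 0 := by
      simp_rw [hAσ]
      have h1 : Integrable (fun ω => N (σ ω) ω - n₀) P := hNint.sub (integrable_const _)
      rw [integral_sub h1 hMint, integral_sub hNint (integrable_const _), hNn₀, hMzero]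
      simp
    exact (integral_eq_zero_iff_of_nonneg (fun ω => hAnonneg ω _ (hσρ ω)) hAint).1 hAz
  -- The index with `τ n ω > ρ ω` depends on `ω`, so the null sets for all `n` are discarded
  -- together. Then `A = 0` at `ρ`, against the lower bound `g₀ / 2 * (ρ - t) > 0`.
  have hfalse : ∀ᵐ ω ∂P, False := by
    filter_upwards [ae_all_iff.2 hzero, hτ.tendsto_top] with ω hω hlim
    obtain ⟨n, hn⟩ := (hlim.eventually (lt_mem_nhds (WithTop.coe_lt_top (ρ ω)))).exists
    have h := hω n
    rw [min_eq_left hn.le] at h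
    have h' : A (ρ ω) ω = 0 := h
    have h1 := hAlow ω (ρ ω) (htρ ω).le le_rfl
    have h2 : (0 : ℝ) < (ρ ω : ℝ) - t := sub_pos.2 (by exact_mod_cast htρ ω)
    rw [h'] at h1
    nlinarith
  simp at hfalse
  exact IsProbabilityMeasure.ne_zero P hfalse

/-! ### Change of measure. -/

/-- Bayes: a martingale under the measure with density process `L` becomes a `P`-martingale when
multiplied by `L`. -/
theorem MeasureTheory.Martingale.mul_of_withDensity [IsFiniteMeasure P] {L R : ℝ≥0 → Ω → ℝ}
    {n : ℝ≥0} (hL : Martingale L F P) (hL₀ : ∀ ω, 0 ≤ L n ω) (hLn : ∀ s, n ≤ s → L s = L n)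
    (hR : Martingale R F (P.withDensity fun ω => ENNReal.ofReal (L n ω))) :
    Martingale (fun s ω => R s ω * L s ω) F P := by
  have : IsFiniteMeasure (P.withDensity fun ω => ENNReal.ofReal (L n ω)) :=
    isFiniteMeasure_withDensity_ofReal (hL.integrable n).2
  have hmeas : Measurable fun ω => ENNReal.ofReal (L n ω) :=
    ENNReal.measurable_ofReal.comp (((hL.1 n).mono (F.le n)).measurable)
  -- Since `L` is constant after `n`, this holds for times on both sides of `n`.
  have hcond : ∀ j, P[L n | F j] =ᵐ[P] L j := by
    intro j
    rcases le_total j n with h | h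
    · exact hL.condExp_ae_eq h
    · rw [← hLn j h]; exact hL.condExp_ae_eq le_rfl
  have hint : ∀ j, Integrable (R j * L n) P := by
    intro j
    have := (integrable_withDensity_iff_integrable_smul' hmeas (by simp)).1 (hR.integrable j)
    refine this.congr (ae_of_all _ fun ω => ?_)
    simp [ENNReal.toReal_ofReal (hL₀ ω), mul_comm]
  have hpull : ∀ j, P[R j * L n | F j] =ᵐ[P] fun ω => R j ω * L j ω := by
    intro j
    refine (condExp_mul_of_stronglyMeasurable_left (hR.1 j) (hint j) (hL.integrable n)).trans ?_
    filter_upwards [hcond j] with ω hω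
    simp [hω]
  -- Integrability of the product needs no bound on either factor: it is a conditional expectation
  -- of `R j * L n`, which is integrable because `R j` is integrable under the new measure.
  have hmulint : ∀ j, Integrable (fun ω => R j ω * L j ω) P := fun j =>
    integrable_condExp.congr (hpull j)
  have hset : ∀ i j, i ≤ j → ∀ s, MeasurableSet[F i] s →
      ∫ ω in s, R j ω * L j ω ∂P
        = ∫ ω in s, R j ω ∂(P.withDensity fun ω => ENNReal.ofReal (L n ω)) := by
    intro i j hij s hs
    rw [setIntegral_withDensity_eq_setIntegral_toReal_smul hmeas (by simp) _ (F.le i _ hs),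
      ← setIntegral_congr_ae (F.le i _ hs) ((hpull j).mono fun ω h _ => h),
      setIntegral_condExp (F.le j) (hint j) (F.mono hij _ hs)]
    refine integral_congr_ae (ae_of_all _ fun ω => ?_)
    simp [ENNReal.toReal_ofReal (hL₀ ω), mul_comm]
  refine ⟨fun j => (hR.1 j).mul (hL.1 j), fun i j hij => ?_⟩
  refine (ae_eq_condExp_of_forall_setIntegral_eq (F.le i) (hmulint j)
    (fun s _ _ => (hmulint i).integrableOn) (fun s hs _ => ?_)
    ((hR.1 i).mul (hL.1 i)).aestronglyMeasurable).symm
  rw [hset i i le_rfl s hs, hset i j hij s hs]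
  exact hR.setIntegral_eq hij hs

end Martingales

/-! ## The discounted technology weighted by the likelihood -/

/-- Reduces derivatives on the five-dimensional state space to one-variable calculus along a line.
-/
theorem fderiv_apply_eq_of_hasDerivAt_line {E : Type*} [NormedAddCommGroup E] [NormedSpace ℝ E]
    {f : E → ℝ} {z v : E} {c : ℝ} (hf : DifferentiableAt ℝ f z)
    (h : HasDerivAt (fun h : ℝ => f (z + h • v)) c 0) : fderiv ℝ f z v = c := by
  rw [← hf.lineDeriv_eq_fderiv]
  exact h.deriv

/-- `ε S L / B` as a function of the market system `(X, S, B, L)` and the Wiener process. -/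
noncomputable def deflatedTechnology (ε : ℝ) (z : (ℝ × ℝ × ℝ × ℝ) × ℝ) : ℝ :=
  ε * (z.1.2.1 * z.1.2.2.2 / z.1.2.2.1)

theorem contDiffAt_deflatedTechnology (ε : ℝ) {z : (ℝ × ℝ × ℝ × ℝ) × ℝ} (hz : z.1.2.2.1 ≠ 0) :
    ContDiffAt ℝ 2 (deflatedTechnology ε) z := by
  unfold deflatedTechnology
  fun_prop (disch := exact hz)

theorem fderiv_deflatedTechnology (ε : ℝ) {z : (ℝ × ℝ × ℝ × ℝ) × ℝ} (hz : z.1.2.2.1 ≠ 0)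
    (v : (ℝ × ℝ × ℝ × ℝ) × ℝ) :
    fderiv ℝ (deflatedTechnology ε) z v
      = ε * (v.1.2.1 * z.1.2.2.2 / z.1.2.2.1 + z.1.2.1 * v.1.2.2.2 / z.1.2.2.1
        - z.1.2.1 * z.1.2.2.2 * v.1.2.2.1 / z.1.2.2.1 ^ 2) := by
  refine fderiv_apply_eq_of_hasDerivAt_line
    ((contDiffAt_deflatedTechnology ε hz).differentiableAt (by norm_num)) ?_
  have hlin : ∀ p q : ℝ, HasDerivAt (fun h : ℝ => p + h * q) q 0 := fun p q => by
    simpa using ((hasDerivAt_id (0 : ℝ)).mul_const q).const_add p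
  have h := ((((hlin z.1.2.1 v.1.2.1).mul (hlin z.1.2.2.2 v.1.2.2.2)).div
    (hlin z.1.2.2.1 v.1.2.2.1) (by simpa using hz)).const_mul ε)
  refine h.congr_deriv ?_
  simp only [Pi.mul_apply, zero_mul, add_zero]
  field_simp

/-- The first order part contributes `b₂` from `S` and `-b₃` from `B`. As `B` has no diffusion and
`S`, `L` enter bilinearly, the only second order term is the mixed one in `S` and `L`; it occurs
twice, which cancels the factor `1/2` and leaves `a₂ * a₄`. -/
theorem itoOperator_deflatedTechnology (ε : ℝ) {z : (ℝ × ℝ × ℝ × ℝ) × ℝ} (hz : z.1.2.2.1 ≠ 0)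
    (b₁ b₂ b₃ a₁ a₂ a₄ : ℝ) :
    itoOperator (b₁, b₂ * z.1.2.1, b₃ * z.1.2.2.1, (0 : ℝ))
        (a₁, a₂ * z.1.2.1, (0 : ℝ), a₄ * z.1.2.2.2) (deflatedTechnology ε) z
      = ε * ((b₂ - b₃ + a₂ * a₄) * (z.1.2.1 * z.1.2.2.2 / z.1.2.2.1)) := by
  set v : (ℝ × ℝ × ℝ × ℝ) × ℝ := ((a₁, a₂ * z.1.2.1, (0 : ℝ), a₄ * z.1.2.2.2), 1) with hv
  have hdiff : DifferentiableAt ℝ (fderiv ℝ (deflatedTechnology ε)) z :=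
    ((contDiffAt_deflatedTechnology ε hz).fderiv_right (m := 1) (by norm_num)).differentiableAt
      (by norm_num)
  -- The direction `v` is fixed and has zero `B` component, so the quotient-rule term drops out
  -- before the second differentiation.
  have hev : (fun z' => fderiv ℝ (deflatedTechnology ε) z' v) =ᶠ[𝓝 z] fun z' =>
      ε * (v.1.2.1 * z'.1.2.2.2 / z'.1.2.2.1 + z'.1.2.1 * v.1.2.2.2 / z'.1.2.2.1) := by
    have hopen : ∀ᶠ z' : (ℝ × ℝ × ℝ × ℝ) × ℝ in 𝓝 z, z'.1.2.2.1 ≠ 0 :=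
      ContinuousAt.eventually_ne (by fun_prop) hz
    filter_upwards [hopen] with z' hz'
    rw [fderiv_deflatedTechnology ε hz']
    simp [hv]
  have hsecond : iteratedFDeriv ℝ 2 (deflatedTechnology ε) z (fun _ => v)
      = 2 * ε * (a₂ * a₄ * (z.1.2.1 * z.1.2.2.2 / z.1.2.2.1)) := by
    rw [iteratedFDeriv_two_apply]
    have h1 : fderiv ℝ (fderiv ℝ (deflatedTechnology ε)) z v v
        = fderiv ℝ (fun z' => fderiv ℝ (deflatedTechnology ε) z' v) z v := by
      rw [fderiv_clm_apply hdiff (differentiableAt_const _)]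
      simp
    rw [h1, hev.fderiv_eq]
    refine fderiv_apply_eq_of_hasDerivAt_line (by fun_prop (disch := exact hz)) ?_
    have hlin : ∀ p q : ℝ, HasDerivAt (fun h : ℝ => p + h * q) q 0 := fun p q => by
      simpa using ((hasDerivAt_id (0 : ℝ)).mul_const q).const_add p
    have h := ((((hlin z.1.2.2.2 v.1.2.2.2).const_mul v.1.2.1).div_const z.1.2.2.1).add
      (((hlin z.1.2.1 v.1.2.1).mul_const v.1.2.2.2).div_const z.1.2.2.1)).const_mul ε
    refine (h.congr_deriv ?_).congr_of_eventuallyEq (Eventually.of_forall fun u => ?_)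
    · simp only [hv]
      field_simp
      ring
    · simp [hv]
  rw [itoOperator, hsecond, fderiv_deflatedTechnology ε hz]
  field_simp
  ring

/-! ## Equilibrium conditions -/

/-- Only the values of the coefficients on the state space and the time interval matter. -/
theorem SolvesSDE.congr_coeff {Ω : Type*} [MeasurableSpace Ω] {E : Type*} [NormedAddCommGroup E]
    [NormedSpace ℝ E] {𝔅 : WienerBasis Ω} {b a b' a' : ℝ → E → E} {O : Set E} {T t : ℝ≥0} {y₀ : E}
    {Y : ℝ≥0 → Ω → E} (hb : ∀ q ∈ Ico (0 : ℝ) T, ∀ y ∈ O, b q y = b' q y)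
    (ha : ∀ q ∈ Ico (0 : ℝ) T, ∀ y ∈ O, a q y = a' q y) (h : SolvesSDE 𝔅 b a O T t y₀ Y) :
    SolvesSDE 𝔅 b' a' O T t y₀ Y := by
  have hq : ∀ {q : ℝ} {t' : ℝ≥0}, t' ∈ Ico t T → q ∈ Icc (t : ℝ) t' →
      q ∈ Ico (0 : ℝ) T ∧ q.toNNReal ∈ Ico t T := by
    intro q t' ht' hq
    have h0 : 0 ≤ q := t.2.trans hq.1
    have hT : q < T := hq.2.trans_lt (by exact_mod_cast ht'.2)
    refine ⟨⟨h0, hT⟩, ?_, ?_⟩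
    · rw [← NNReal.coe_le_coe, Real.coe_toNNReal _ h0]; exact hq.1
    · rw [← NNReal.coe_lt_coe, Real.coe_toNNReal _ h0]; exact hT
  refine ⟨h.adapted, h.mem, h.continuousOn, h.initial, ?_, ?_, ?_⟩
  · filter_upwards [h.drift_integrable] with ω hω t' ht'
    refine (hω t' ht').congr_fun (fun q hqm => ?_) measurableSet_Icc
    exact hb q (hq ht' hqm).1 _ (h.mem _ (hq ht' hqm).2 ω)
  · filter_upwards [h.diffusion_memLp] with ω hω t' ht'
    refine (hω t' ht').ae_eq ((ae_restrict_iff' measurableSet_Icc).2 (ae_of_all _ fun q hqm => ?_))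
    exact ha q (hq ht' hqm).1 _ (h.mem _ (hq ht' hqm).2 ω)
  · intro t' ht' ψ hψ
    convert h.localMartingale t' ht' ψ hψ using 3 with s ω
    simp only [itoDefect]
    congr 1
    have hmem := clampTime_mem ht'.1 s
    refine intervalIntegral.integral_congr fun q hqm => ?_
    rw [uIcc_of_le (by exact_mod_cast hmem.1)] at hqm
    have hqm' : q ∈ Icc (t : ℝ) t' := ⟨hqm.1, hqm.2.trans (by exact_mod_cast hmem.2)⟩
    simp only [hb q (hq ht' hqm').1 _ (h.mem _ (hq ht' hqm').2 ω),
      ha q (hq ht' hqm').1 _ (h.mem _ (hq ht' hqm').2 ω)]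

namespace ProductionEconomy

variable {Ω : Type*} [MeasurableSpace Ω]

/-! ### No arbitrage. -/

/-- No arbitrage: the Girsanov kernel turns the excess return of the technology into zero. -/
theorem IsGirsanovKernel.drift_eq_zero {𝔅 : WienerBasis Ω} {𝓔 : ProductionEconomy}
    {r φ : ℝ → ℝ → ℝ} {w : FeedbackLaw}
    (hr : ContinuousOn (fun p : ℝ × ℝ => r p.1 p.2) 𝓔.domain)
    (hφ : 𝓔.IsGirsanovKernel 𝔅 r w φ) {t x : ℝ} (htx : (t, x) ∈ 𝓔.domain) :
    𝓔.α - r t x + 𝓔.σ * φ t x = 0 := by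
  obtain ⟨⟨ht0, htT⟩, hx⟩ := htx
  lift t to ℝ≥0 using ht0
  have htT : t < 𝓔.T := by exact_mod_cast htT
  have := 𝔅.isProbabilityMeasure
  have := 𝔅.rightContinuous
  obtain ⟨X, S, B, L, hY, hmart⟩ := hφ.martingaleMeasure t htT x hx
  obtain ⟨t', htt', ht'T⟩ := exists_between htT
  have ht' : t' ∈ Ico t 𝓔.T := ⟨htt'.le, ht'T⟩
  obtain ⟨hL, hSB⟩ := hmart t' ht'
  set c : ℝ≥0 → ℝ≥0 := clampTime t t' with hc
  have hcI : ∀ s, c s ∈ Ico t 𝓔.T := fun s =>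
    ⟨(clampTime_mem htt'.le s).1, (clampTime_mem htt'.le s).2.trans_lt ht'T⟩
  have hct : c t' = t' := clampTime_of_mem ⟨htt'.le, le_rfl⟩
  have hpos : ∀ s ∈ Ico t 𝓔.T, ∀ ω, 0 < X s ω ∧ 0 < S s ω ∧ 0 < B s ω ∧ 0 < L s ω := hY.mem
  have hYc : ∀ ω, Continuous fun s => (X (c s) ω, S (c s) ω, B (c s) ω, L (c s) ω) := fun ω =>
    (hY.continuousOn ω).comp_continuous (continuous_clampTime t t') hcI
  have hXc : ∀ ω, Continuous fun s => X (c s) ω := fun ω => (hYc ω).fst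
  have hSc : ∀ ω, Continuous fun s => S (c s) ω := fun ω => (hYc ω).snd.fst
  have hBc : ∀ ω, Continuous fun s => B (c s) ω := fun ω => (hYc ω).snd.snd.fst
  have hLc : ∀ ω, Continuous fun s => L (c s) ω := fun ω => (hYc ω).snd.snd.snd
  have hini : ∀ ω, X t ω = x ∧ S t ω = 1 ∧ B t ω = 1 ∧ L t ω = 1 := fun ω => by
    simpa using hY.initial ω
  have hct0 : ∀ s ≤ t, c s = t := fun s hs => clampTime_of_le hs
  -- the product of the discounted technology and the likelihood is a martingale under `P`
  have hN : Martingale (fun s ω => S (c s) ω / B (c s) ω * L (c s) ω) 𝔅.filt 𝔅.P := by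
    refine Martingale.mul_of_withDensity (n := t') hL (fun ω => ?_) (fun s hs => ?_) ?_
    · exact (hpos _ (hcI t') ω).2.2.2.le
    · have : c s = t' := by simp [hc, clampTime, hs, htt'.le]
      simp only [this, hct]
    · simp only [hct]
      exact hSB
  set k : ℝ × ℝ → ℝ := fun p => 𝓔.α - r p.1 p.2 + 𝓔.σ * φ p.1 p.2 with hk
  have hkc : ContinuousOn k 𝓔.domain :=
    (continuousOn_const.sub hr).add (continuousOn_const.mul hφ.continuousOn)
  have hdom : ∀ s ∈ Ico t 𝓔.T, ∀ ω, ((s : ℝ), X s ω) ∈ 𝓔.domain := fun s hs ω =>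
    ⟨⟨s.2, by exact_mod_cast hs.2⟩, (hpos s hs ω).1⟩
  -- The drift of `SL/B`, frozen outside `[t, t']` so that it is continuous at all times; at `t` it
  -- equals `k (t, x)` because `S = B = L = 1` there.
  set g : ℝ≥0 → Ω → ℝ := fun s ω => k ((c s : ℝ), X (c s) ω) * (S (c s) ω * L (c s) ω / B (c s) ω)
    with hg
  have hgcont : ∀ ω, Continuous fun s => g s ω := by
    intro ω
    refine Continuous.mul (hkc.comp_continuous ?_ fun s => hdom _ (hcI s) ω)
      (((hSc ω).mul (hLc ω)).div (hBc ω) fun s => (hpos _ (hcI s) ω).2.2.1.ne')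
    exact (NNReal.continuous_coe.comp (continuous_clampTime t t')).prodMk (hXc ω)
  have hgt : ∀ ω, ∀ s ≤ t, g s ω = k (t, x) := fun ω s hs => by
    simp [hg, hct0 s hs, hini ω]
  have hgad : StronglyAdapted 𝔅.filt g := by
    intro s
    -- Before `t` the clamped time `c s = t` lies in the future, so adaptedness rests on the
    -- deterministic initial value.
    rcases le_total s t with hs | hs
    · have : g s = fun _ => k (t, x) := funext fun ω => hgt ω s hs
      rw [this]
      exact stronglyMeasurable_const
    · have hcs : c s ≤ s := max_le hs (min_le_left _ _)
      have hYm := (hY.adapted _ (hcI s)).measurable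
      have hXm := hYm.fst
      have hprod : Measurable[𝔅.filt (c s)]
          fun ω => S (c s) ω * L (c s) ω / B (c s) ω :=
        (hYm.snd.fst.mul hYm.snd.snd.snd).div hYm.snd.snd.fst
      have hkm : Measurable[𝔅.filt (c s)] fun ω => k ((c s : ℝ), X (c s) ω) := by
        -- Continuity of `k` is known only on the domain, so measurability passes through the
        -- subtype of positive wealth.
        have h1 : Continuous fun y : Ioi (0 : ℝ) => k ((c s : ℝ), (y : ℝ)) :=
          hkc.comp_continuous (by fun_prop) fun y => ⟨⟨(c s).2, by exact_mod_cast (hcI s).2⟩, y.2⟩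
        exact h1.measurable.comp (hXm.subtype_mk (h := fun ω => (hpos _ (hcI s) ω).1))
      exact ((hkm.mul hprod).mono (𝔅.filt.mono hcs) le_rfl).stronglyMeasurable
  -- The factor `ε` lets one application of `drift_nonpos` serve both signs; `ε = 1` and `ε = -1`
  -- give equality.
  have hε : ∀ ε : ℝ, ε * k (t, x) ≤ 0 := by
    intro ε
    refine drift_nonpos (P := 𝔅.P) (F := 𝔅.filt) htt' (n₀ := ε)
      (N := fun s ω => ε * (S (c s) ω / B (c s) ω * L (c s) ω)) (G := fun s ω => ε * g s ω)
      (hN.smul ε) ?_ ?_ ?_ ?_ ?_ ?_ ?_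
    · exact fun ω => continuous_const.mul
        (((hSc ω).div (hBc ω) fun s => (hpos _ (hcI s) ω).2.2.1.ne').mul (hLc ω))
    · intro ω
      simp [hct0 0 zero_le, hini ω]
    · exact fun s => (hgad s).const_mul ε
    · exact fun ω => continuous_const.mul (hgcont ω)
    · exact fun ω => by rw [hgt ω t le_rfl]
    · exact fun ω s hs => by rw [hgt ω s hs]
    · have hψ : ContDiffOn ℝ 2 (deflatedTechnology ε)
          ((Ioi 0 ×ˢ Ioi 0 ×ˢ Ioi 0 ×ˢ Ioi 0) ×ˢ univ) := fun z hz =>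
        (contDiffAt_deflatedTechnology ε (ne_of_gt hz.1.2.2.1)).contDiffWithinAt
      convert hY.localMartingale t' ht' _ hψ using 3 with s ω
      simp only [itoDefect, deflatedTechnology, hini ω, ← hc]
      congr 1
      · ring
      · refine intervalIntegral.integral_congr fun q hq => ?_
        have hmem := clampTime_mem htt'.le s
        rw [uIcc_of_le (by exact_mod_cast hmem.1)] at hq
        have hq0 : 0 ≤ q := t.2.trans hq.1
        have hqI : q.toNNReal ∈ Icc t t' := by
          constructor
          · rw [← NNReal.coe_le_coe, Real.coe_toNNReal _ hq0]; exact hq.1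
          · rw [← NNReal.coe_le_coe, Real.coe_toNNReal _ hq0]
            exact hq.2.trans (by exact_mod_cast hmem.2)
        have hcq : c q.toNNReal = q.toNNReal := clampTime_of_mem hqI
        have hB : B q.toNNReal ω ≠ 0 :=
          (hpos _ ⟨hqI.1, hqI.2.trans_lt ht'T⟩ ω).2.2.1.ne'
        simp only [hg, hcq, Real.coe_toNNReal _ hq0, hk]
        exact (itoOperator_deflatedTechnology ε (z := ((X q.toNNReal ω, S q.toNNReal ω,
          B q.toNNReal ω, L q.toNNReal ω), 𝔅.W q.toNNReal ω)) hB _ _ _ _ _ _).symm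
  have h1 := hε 1
  have h2 := hε (-1)
  have h3 : k (t, x) = 0 := by linarith
  exact h3

variable {𝔅 : WienerBasis Ω} {𝓔 : ProductionEconomy} {r : ℝ → ℝ → ℝ} {w : FeedbackLaw}
  {f : ℝ → ℝ → ℝ → ℝ → ℝ}

/-! ### First order conditions in the Hamiltonian. -/

/-- With the whole wealth invested in production, the short rate drops out of the generator. -/
theorem generator_one (𝓔 : ProductionEconomy) (r : ℝ → ℝ → ℝ) (c : ℝ) (f : ℝ → ℝ → ℝ → ℝ → ℝ)
    (t x s y : ℝ) :
    𝓔.generator r 1 c f t x s y = dT f t x s y + (𝓔.α * x - c) * dX f t x s y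
      + 1 / 2 * x ^ 2 * 𝓔.σ ^ 2 * dXX f t x s y := by
  simp only [generator, wealthDrift, wealthVol]
  ring

theorem SolvesExtendedHJB.hamiltonian_le (hf : 𝓔.SolvesExtendedHJB 𝔅 r w f) {t x : ℝ}
    (h : (t, x) ∈ 𝓔.domain) {u c : ℝ} (hu : 0 ≤ u) (hc : c ∈ 𝓔.C) :
    𝓔.U t x t c + 𝓔.generator r u c f t x t x ≤ 0 :=
  (hf.sup_eq_zero _ h).1 ⟨u, c, hu, hc, rfl⟩

/-- First order condition for the portfolio weight at the interior optimum `û = 1`. -/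
theorem SolvesExtendedHJB.portfolio_foc (hf : 𝓔.SolvesExtendedHJB 𝔅 r w f) {t x : ℝ}
    (h : (t, x) ∈ 𝓔.domain) (hu : w.u t x = 1) (hc : w.c t x ∈ 𝓔.C) :
    (𝓔.α - r t x) * dX f t x t x + 𝓔.σ ^ 2 * (x * dXX f t x t x) = 0 := by
  have hx : 0 < x := h.2
  have hopt : 𝓔.U t x t (w.c t x) + 𝓔.generator r 1 (w.c t x) f t x t x = 0 := by
    have := hf.sup_realized _ h
    simpa only [hu] using this
  -- The constraint `u ≥ 0` is not binding near `1`, so the constrained maximum is a local one.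
  have hmax : IsLocalMax (fun u => 𝓔.U t x t (w.c t x) + 𝓔.generator r u (w.c t x) f t x t x) 1 := by
    filter_upwards [lt_mem_nhds (zero_lt_one' ℝ)] with u hu0
    rw [hopt]
    exact hf.hamiltonian_le h hu0.le hc
  have hderiv : HasDerivAt
      (fun u => 𝓔.U t x t (w.c t x) + 𝓔.generator r u (w.c t x) f t x t x)
      (x * ((𝓔.α - r t x) * dX f t x t x + 𝓔.σ ^ 2 * (x * dXX f t x t x))) 1 := by
    have hid := hasDerivAt_id (1 : ℝ)
    have h1 := ((((hid.const_mul x).mul_const (𝓔.α - r t x)).add_const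
      (r t x * x - w.c t x)).mul_const (dX f t x t x)).const_add (dT f t x t x)
    have h2 := ((((hid.const_mul x).mul_const 𝓔.σ).pow 2).const_mul (1 / 2)).mul_const
      (dXX f t x t x)
    refine ((h1.add h2).const_add (𝓔.U t x t (w.c t x))).congr_deriv ?_
    simp
    ring
  have := hmax.hasDerivAt_eq_zero hderiv
  exact (mul_eq_zero.1 this).resolve_left hx.ne'

/-- First order condition for an interior consumption rate. -/
theorem SolvesExtendedHJB.consumption_foc (hf : 𝓔.SolvesExtendedHJB 𝔅 r w f) {t x : ℝ}
    (h : (t, x) ∈ 𝓔.domain) (hu : 0 ≤ w.u t x) (hc : 0 < w.c t x)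
    (hU : DifferentiableAt ℝ (fun c => 𝓔.U t x t c) (w.c t x)) :
    HasDerivAt (fun c => 𝓔.U t x t c) (dX f t x t x) (w.c t x) := by
  have hmax : IsLocalMax (fun c => 𝓔.U t x t c + 𝓔.generator r (w.u t x) c f t x t x)
      (w.c t x) := by
    -- Rates near a positive one are positive, hence in `𝓔.C` whether or not zero consumption is
    -- allowed.
    filter_upwards [lt_mem_nhds hc] with c hc0
    exact (hf.hamiltonian_le h hu (𝓔.Ioi_subset_C hc0)).trans (hf.sup_realized _ h).ge
  have hgen : HasDerivAt (fun c => 𝓔.generator r (w.u t x) c f t x t x) (-dX f t x t x)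
      (w.c t x) := by
    have h1 := ((((hasDerivAt_id (w.c t x)).const_sub (r t x * x)).const_add
      (x * w.u t x * (𝓔.α - r t x))).mul_const (dX f t x t x)).const_add (dT f t x t x)
    refine (h1.add_const (1 / 2 * 𝓔.wealthVol (w.u t x) x ^ 2 * dXX f t x t x)).congr_deriv ?_
    ring
  have hzero := hmax.hasDerivAt_eq_zero (hU.hasDerivAt.add hgen)
  refine hU.hasDerivAt.congr_deriv ?_
  linarith

end ProductionEconomy
theorem proposition14p1 {Ω : Type*} [MeasurableSpace Ω] (𝔅 : WienerBasis Ω)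
    (𝓔 : ProductionEconomy)
    -- the short rate function, the law `w = (û, ĉ)` and the function `f(t, x, s, y)`
    (r : ℝ → ℝ → ℝ) (w : FeedbackLaw) (f : ℝ → ℝ → ℝ → ℝ → ℝ)
    (hr : ContinuousOn (fun p : ℝ × ℝ => r p.1 p.2) 𝓔.domain)
    (heq : 𝓔.IsMarketEquilibrium 𝔅 r w)
    (hf : 𝓔.SolvesExtendedHJB 𝔅 r w f)
    -- the utility is differentiable in consumption and the optimum is interior
    (hU : ∀ p ∈ 𝓔.domain, ∀ c > 0, DifferentiableAt ℝ (fun c' => 𝓔.U p.1 p.2 p.1 c') c)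
    (hc : ∀ p ∈ 𝓔.domain, 0 < w.c p.1 p.2)
    -- the denominators do not vanish
    (hfx : ∀ p ∈ 𝓔.domain, dX f p.1 p.2 p.1 p.2 ≠ 0) :
    -- the equilibrium short rate
    (∀ t x : ℝ, (t, x) ∈ 𝓔.domain →
      r t x = 𝓔.α + 𝓔.σ ^ 2 * (x * dXX f t x t x / dX f t x t x)) ∧
    -- the equilibrium Girsanov kernel
    (∀ φ : ℝ → ℝ → ℝ, 𝓔.IsGirsanovKernel 𝔅 r w φ → ∀ t x : ℝ, (t, x) ∈ 𝓔.domain →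
      φ t x = 𝓔.σ * (x * dXX f t x t x / dX f t x t x)) ∧
    -- the extended equilibrium HJB system
    (∀ t x : ℝ, (t, x) ∈ 𝓔.domain →
      𝓔.U t x t (w.c t x) + dT f t x t x + (𝓔.α * x - w.c t x) * dX f t x t x
        + 1 / 2 * x ^ 2 * 𝓔.σ ^ 2 * dXX f t x t x = 0) ∧
    (∀ s y t x : ℝ, (s, y) ∈ 𝓔.domain → (t, x) ∈ 𝓔.domain →
      𝓔.generator r 1 (w.c t x) f t x s y + 𝓔.U s y t (w.c t x) = 0 ∧
      𝓔.generator r 1 (w.c t x) f t x s y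
        = dT f t x s y + (𝓔.α * x - w.c t x) * dX f t x s y
          + 1 / 2 * x ^ 2 * 𝓔.σ ^ 2 * dXX f t x s y) ∧
    (∀ s y x : ℝ, (s, y) ∈ 𝓔.domain → 0 < x → f 𝓔.T x s y = 0) ∧
    -- the first order condition for consumption
    (∀ t x : ℝ, (t, x) ∈ 𝓔.domain →
      HasDerivAt (fun c => 𝓔.U t x t c) (dX f t x t x) (w.c t x)) ∧
    -- the generator term under the equilibrium law
    (∀ t x : ℝ, (t, x) ∈ 𝓔.domain →
      𝓔.generator r (w.u t x) (w.c t x) f t x t x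
        = dT f t x t x + x * (𝓔.α - r t x) * dX f t x t x
          + (r t x * x - w.c t x) * dX f t x t x
          + 1 / 2 * x ^ 2 * 𝓔.σ ^ 2 * dXX f t x t x) ∧
    -- the equilibrium wealth dynamics `dX = (αX - ĉ) dt + Xσ dW`
    (∀ t < 𝓔.T, ∀ x > 0,
      𝓔.IsWealth 𝔅 r w t x (𝓔.wealth 𝔅 r w t x) ∧
      ∀ X : ℝ≥0 → Ω → ℝ, 𝓔.IsWealth 𝔅 r w t x X ↔
        SolvesSDE 𝔅 (fun s ξ => 𝓔.α * ξ - w.c s ξ) (fun _ ξ => ξ * 𝓔.σ) (Ioi 0) 𝓔.T t x X) := by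

  have hu := heq.clearing
  have hadm := heq.intrapersonal.admissible
  have hfoc : ∀ t x : ℝ, (t, x) ∈ 𝓔.domain →
      (𝓔.α - r t x) * dX f t x t x + 𝓔.σ ^ 2 * (x * dXX f t x t x) = 0 := fun t x h =>
    hf.portfolio_foc h (hu _ h) (hadm.c_mem _ h)
  have hrate : ∀ t x : ℝ, (t, x) ∈ 𝓔.domain →
      r t x = 𝓔.α + 𝓔.σ ^ 2 * (x * dXX f t x t x / dX f t x t x) := by
    intro t x h
    have h1 := hfoc t x h
    have h2 : dX f t x t x ≠ 0 := hfx _ h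
    field_simp
    linarith
  have hback : ∀ s y t x : ℝ, (s, y) ∈ 𝓔.domain → (t, x) ∈ 𝓔.domain →
      𝓔.generator r 1 (w.c t x) f t x s y + 𝓔.U s y t (w.c t x) = 0 := by
    intro s y t x hs h
    have := hf.backward _ hs _ h
    simpa only [hu _ h] using this
  refine ⟨hrate, ?_, ?_, ?_, ?_, ?_, ?_, ?_⟩
  · intro φ hφ t x h
    have h1 := hφ.drift_eq_zero hr h
    rw [hrate t x h] at h1
    -- With the short rate inserted, no arbitrage reads `σφ = σ² x f_xx / f_x`.
    refine mul_left_cancel₀ 𝓔.σ_ne_zero ?_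
    linear_combination h1
  · intro t x h
    -- On the diagonal `(s, y) = (t, x)` the backward equation is the HJB equation.
    have h1 := hback t x t x h h
    rw [𝓔.generator_one] at h1
    linarith
  · exact fun s y t x hs h => ⟨hback s y t x hs h, 𝓔.generator_one r _ f t x s y⟩
  · exact fun s y x hs hx => hf.terminal _ hs x hx
  · exact fun t x h => hf.consumption_foc h (hadm.u_nonneg _ h) (hc _ h) (hU _ h _ (hc _ h))
  · intro t x h
    have h1 : w.u t x = 1 := hu _ h
    rw [h1]
    simp only [ProductionEconomy.generator, ProductionEconomy.wealthDrift,
      ProductionEconomy.wealthVol]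
    ring
  · intro t ht x hx
    -- Clearing holds only on the domain, which is enough: the coefficients need to agree only where
    -- positive solutions live.
    have hcoef : ∀ q ∈ Ico (0 : ℝ) 𝓔.T, ∀ y ∈ Ioi (0 : ℝ),
        𝓔.wealthDrift r (w.u q y) (w.c q y) q y = 𝓔.α * y - w.c q y ∧
        𝓔.wealthVol (w.u q y) y = y * 𝓔.σ := by
      intro q hq y hy
      have h1 : w.u q y = 1 := hu (q, y) ⟨hq, hy⟩
      simp only [h1, ProductionEconomy.wealthDrift, ProductionEconomy.wealthVol]
      constructor <;> ring
    refine ⟨Classical.epsilon_spec (hadm.exists_wealth t ht x hx), fun X => ⟨fun h => ?_,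
      fun h => ?_⟩⟩
    · exact SolvesSDE.congr_coeff (fun q hq y hy => (hcoef q hq y hy).1)
        (fun q hq y hy => (hcoef q hq y hy).2) h
    · exact SolvesSDE.congr_coeff (fun q hq y hy => (hcoef q hq y hy).1.symm)
        (fun q hq y hy => (hcoef q hq y hy).2.symm) h
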